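/- Let $m\ge 1$, $p>1$, $1/p+1/q=1$. Let $\boldsymbol\mu=(\mu_1,\dots,\mu_m)$ be a centered peacock, i.e. probability measures on $\mathbb R$ with finite first moment and mean zero such that $i\mapsto\mu_i(\phi)=\int\phi\,d\mu_i$ is non-decreasing for every convex $\phi:\mathbb R\to\mathbb R$, and assume $V:=\mu_m(|x|^p)<\infty$. Let $\overline\Omega$ be the set of pairs $(\omega,\theta)$, where $\omega:\mathbb R_+\to\mathbb R$ is continuous with $\omega_0=0$ and $0\le\theta_1\le\dots\le\theta_m<\infty$, with the product topology (locally uniform convergence of paths), canonical element $(B,T)$, $T=(T_1,\dots,T_m)$, and canonical filtration $\overline{\mathcal F}_t=\sigma(B_s,\,s\le t)\vee\sigma(\{T_i\le s\},\,s\le t,\,1\le i\le m)$. Let $\overline{\mathcal P}$ be the set of Borel probability measures on $\overline\Omega$ under which $B$ is an $\overline{\mathbb F}$-Brownian motion and $(B_{T_m\wedge t})_{t\ge0}$ is uniformly integrable. For strikes $\boldsymbol K^n=(K^n_1<\dots<K^n_n)$, $n\ge1$, and the prices $C^n_{i,j}=\mu_i\big((x-K^n_j)^+\big)$, a $(\boldsymbol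 K^n,\boldsymbol C^n)$-embedding is a $\overline{\mathbb P}\in\overline{\mathcal P}$ with $\mathbb E^{\overline{\mathbb P}}[(B_{T_i}-K^n_j)^+]=C^n_{i,j}$ for all $i\le m$, $j\le n$. Put $$|\boldsymbol K^n|=(K^n_1)^-\wedge(K^n_n)^+,\qquad \Delta\boldsymbol K^n=\max_{1<j\le n}(K^n_j-K^n_{j-1}).$$ For probability measures $\mu,\nu$ on $\mathbb R$ with distribution functions $F_\mu,F_\nu$ let $$\rho(\mu,\nu)=\inf\{\varepsilon>0:\ F_\mu(x-\varepsilon)-\varepsilon\le F_\nu(x)\le F_\mu(x+\varepsilon)+\varepsilon\ \ \forall x\in\mathbb R\},\qquad W(\mu,\nu)=\inf_\chi\int_{\mathbb R^2}|x-y|\,d\chi(x,y),$$ where $\chi$ ranges over the couplings of $\mu$ and $\nu$. **Proposition.** For every $V$ there is a constant $C>0$, depending only on $V$, such that for all $p,q,m,\boldsymbol\mu$ as above with $\mu_m(|x|^p)=V$, all $n\ge1$, all strikes $\boldsymbol K^n$ with $|\boldsymbol K^n|>0$, every $(\boldsymbol K^n,\boldsymbol C^n)$-embedding $\overline{\mathbb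 P}$ (in particular every one with $\mathbb E^{\overline{\mathbb P}}[|B_{T_m}|^p]=V$) and every $i=1,\dots,m$, the law $\nu_i=\overline{\mathbb P}\circ(B_{T_i})^{-1}$ satisfies $$\rho(\mu_i,\nu_i)\le C\Big(\sqrt{\Delta\boldsymbol K^n}+|\boldsymbol K^n|^{-p/(2q)}\Big),$$ and, if moreover $|\boldsymbol K^n|\ge1$ or $p\ge3$, $$W(\mu_i,\nu_i)\le C\,|\boldsymbol K^n|\Big(\sqrt{\Delta\boldsymbol K^n}+|\boldsymbol K^n|^{-p/(2q)}\Big).$$ -/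

import Mathlib

open MeasureTheory ProbabilityTheory
open scoped NNReal ENNReal

namespace CallEmbedding

/-! ### The canonical space -/

/-- Continuous paths `ω : ℝ₊ → ℝ` with `ω 0 = 0`, with the topology of locally uniform convergence
(the compact-open topology). -/
abbrev PathSpace : Type := {ω : C(ℝ≥0, ℝ) // ω 0 = 0}

instance : MeasurableSpace PathSpace := borel PathSpace

instance : BorelSpace PathSpace := ⟨rfl⟩

/-- Ordered families `0 ≤ θ₀ ≤ ⋯ ≤ θₘ` of times, for `m + 1 ≥ 1` maturities. -/
abbrev OrderedTimes (m : ℕ) : Type := {θ : Fin (m + 1) → ℝ≥0 // Monotone θ}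

/-- The product canonical space. Both factors are second countable, so that the product
`σ`-algebra is the Borel `σ`-algebra of the product topology. -/
abbrev CanonicalSpace (m : ℕ) : Type := PathSpace × OrderedTimes m

/-- The canonical process `B`. -/
def path {m : ℕ} (t : ℝ≥0) (w : CanonicalSpace m) : ℝ := w.1.1 t

/-- The canonical times `T_i`. -/
def time {m : ℕ} (i : Fin (m + 1)) (w : CanonicalSpace m) : ℝ≥0 := w.2.1 i

lemma measurable_path {m : ℕ} (t : ℝ≥0) : Measurable (path (m := m) t) := by
  have h : Continuous (fun ω : PathSpace => ω.1 t) :=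
    (ContinuousEvalConst.continuous_eval_const t).comp continuous_subtype_val
  exact h.measurable.comp measurable_fst

lemma measurable_time {m : ℕ} (i : Fin (m + 1)) : Measurable (time i) :=
  (measurable_pi_apply i).comp (measurable_subtype_coe.comp measurable_snd)

/-- The canonical filtration: `σ(B_s, s ≤ t) ∨ σ({T_i ≤ s}, s ≤ t, i)`. -/
def canonicalFiltration (m : ℕ) :
    Filtration ℝ≥0 (inferInstance : MeasurableSpace (CanonicalSpace m)) where
  seq t := (⨆ s : ℝ≥0, ⨆ _ : s ≤ t, MeasurableSpace.comap (path s) inferInstance) ⊔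
    MeasurableSpace.generateFrom
      {A | ∃ i : Fin (m + 1), ∃ s : ℝ≥0, s ≤ t ∧ A = {w : CanonicalSpace m | time i w ≤ s}}
  mono' := by
    intro t u htu
    refine sup_le_sup ?_ (MeasurableSpace.generateFrom_mono ?_)
    · exact iSup_le fun s => iSup_le fun hs => le_iSup₂_of_le s (hs.trans htu) le_rfl
    · rintro A ⟨i, s, hs, rfl⟩
      exact ⟨i, s, hs.trans htu, rfl⟩
  le' := by
    intro t
    refine sup_le ?_ (MeasurableSpace.generateFrom_le ?_)
    · exact iSup_le fun s => iSup_le fun _ => (measurable_path s).comap_le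
    · rintro A ⟨i, s, _, rfl⟩
      exact measurable_time i measurableSet_Iic

/-- The value `B_{T_i}` of the canonical process at the `i`-th canonical time. -/
def embeddedValue {m : ℕ} (i : Fin (m + 1)) (w : CanonicalSpace m) : ℝ := path (time i w) w

/-- The class of probability measures on the canonical space under which `B` is a Brownian motion
with respect to the canonical filtration and the process `B` stopped at the last time `T_m` is
uniformly integrable. -/
structure IsStoppingLaw {m : ℕ} (P : Measure (CanonicalSpace m)) : Prop where
  isProbabilityMeasure : IsProbabilityMeasure P
  isBrownian : IsBrownianReal path P
  indep_increments : ∀ s t : ℝ≥0, s ≤ t →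
    Indep (MeasurableSpace.comap (fun w => path t w - path s w) inferInstance)
      (canonicalFiltration m s) P
  uniformIntegrable :
    UniformIntegrable (fun (t : ℝ≥0) w => path (min (time (Fin.last m) w) t) w) 1 P

/-- `P` is a `(K, c)`-embedding: it reproduces the price `c i j` of the call option of
maturity `i` and strike `K j`. -/
structure IsEmbedding {m n : ℕ} (K : Fin (n + 1) → ℝ) (c : Fin (m + 1) → Fin (n + 1) → ℝ)
    (P : Measure (CanonicalSpace m)) : Prop where
  isStoppingLaw : IsStoppingLaw P
  integrable_call : ∀ i j, Integrable (fun w => max (embeddedValue i w - K j) 0) P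
  price_eq : ∀ i j, ∫ w, max (embeddedValue i w - K j) 0 ∂P = c i j

/-! ### The target marginals and their call prices -/

/-- A centered peacock: probability measures with finite first moment and mean zero that are
increasing in the convex order. The last field says that `μ i φ ≤ μ j φ` in `(-∞, ∞]` for every
convex function `φ`: there is nothing to say when `μ j φ = ∞`. -/
structure IsCenteredPeacock {m : ℕ} (μ : Fin (m + 1) → Measure ℝ) : Prop where
  isProbabilityMeasure : ∀ i, IsProbabilityMeasure (μ i)
  integrable_id : ∀ i, Integrable (fun x : ℝ => x) (μ i)
  mean_zero : ∀ i, ∫ x, x ∂(μ i) = 0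
  convex_order : ∀ i j, i ≤ j → ∀ φ : ℝ → ℝ, ConvexOn ℝ Set.univ φ → Integrable φ (μ j) →
    Integrable φ (μ i) ∧ ∫ x, φ x ∂(μ i) ≤ ∫ x, φ x ∂(μ j)

/-- The call prices `μ i ((x - K j)⁺)`. -/
noncomputable def callPrices {m n : ℕ} (μ : Fin (m + 1) → Measure ℝ) (K : Fin (n + 1) → ℝ)
    (i : Fin (m + 1)) (j : Fin (n + 1)) : ℝ :=
  ∫ x, max (x - K j) 0 ∂(μ i)

/-- The bound `|K|`, the minimum of the negative part of the first strike and the positive part of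
the last strike. -/
noncomputable def strikeBound {n : ℕ} (K : Fin (n + 1) → ℝ) : ℝ :=
  min (max (-(K 0)) 0) (max (K (Fin.last n)) 0)

/-- The mesh `ΔK`, the largest gap between consecutive strikes. -/
noncomputable def mesh {n : ℕ} (K : Fin (n + 1) → ℝ) : ℝ :=
  ⨆ i : Fin n, (K i.succ - K i.castSucc)

/-! ### Metrics on probability measures -/

/-- The Lévy metric, through the cumulative distribution functions. -/
noncomputable def levyDist (μ ν : Measure ℝ) : ℝ :=
  sInf {ε : ℝ | 0 < ε ∧ ∀ x : ℝ, cdf μ (x - ε) - ε ≤ cdf ν x ∧ cdf ν x ≤ cdf μ (x + ε) + ε}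

/-- The Wasserstein metric of order one, as an infimum over all couplings. -/
noncomputable def wassersteinDist (μ ν : Measure ℝ) : ℝ≥0∞ :=
  ⨅ (χ : Measure (ℝ × ℝ)) (_ : χ.map Prod.fst = μ ∧ χ.map Prod.snd = ν),
    ∫⁻ z, ENNReal.ofReal |z.1 - z.2| ∂χ

end CallEmbedding

/-! The embedding enters only through three facts: each `ν i` is integrable, centered, and has the
call prices of `μ i` at the strikes. Centering is optional sampling at `T_i ≤ T_m`, where only the
process stopped at `T_m` is known to be uniformly integrable
(`integrable_and_integral_eq_of_le_stopping`). The rest is analysis on the line. Write `a = |K|`, `δ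
= ΔK`, `s = a ^ (-p/(2q))`. A call function `C` is decreasing while the put function `C x + x` is
increasing, so two call functions agreeing at the strikes differ by at most `δ` between them. Beyond
the strikes both are controlled by the call or put at `±a`, which Markov's inequality bounds by `V *
a ^ (1 - p) = V * s ^ 2`. Hence the call functions are uniformly `η`-close with `η = δ + V * s ^ 2`
(`abs_callFun_sub_le`). Difference quotients over a step `ε` turn this into `ε`-closeness of the
distribution functions once `2 * η ≤ ε ^ 2`; this is the origin of the square roots. For the
Wasserstein distance, the quantile coupling costs at most the integral of `|F_μ - F_ν|`: the Lévy
bound controls it on `(-a, a]`, calls and puts on the tails. If `a < 1` or `δ > 1`, the right-hand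
side is bounded below and first moments suffice. -/

namespace CallEmbedding

open Filter Topology

/-! ### Optional sampling at finite stopping times for continuous martingales -/

section OptionalSampling

variable {Ω : Type*} {m0 : MeasurableSpace Ω} {P : Measure Ω}

/-- If `g k` converges to `Y` in `L¹` and conditional expectations of the `g k` converge almost
surely, then they converge in `L¹`. -/
lemma tendsto_eLpNorm_of_ae_eq_condExp [IsProbabilityMeasure P] {f g : ℕ → Ω → ℝ} {X Y : Ω → ℝ}
    {𝒢 : ℕ → MeasurableSpace Ω} (h𝒢 : ∀ k, 𝒢 k ≤ m0)
    (hf : ∀ k, f k =ᵐ[P] P[g k | 𝒢 k]) (hg : ∀ k, Integrable (g k) P) (hY : Integrable Y P)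
    (hgY : Tendsto (fun k => eLpNorm (g k - Y) 1 P) atTop (𝓝 0))
    (hfX : ∀ ω, Tendsto (fun k => f k ω) atTop (𝓝 (X ω))) :
    Integrable X P ∧ Tendsto (fun k => eLpNorm (f k - X) 1 P) atTop (𝓝 0) := by
  have hfm : ∀ k, AEStronglyMeasurable (f k) P := fun k =>
    (integrable_condExp.congr (hf k).symm).aestronglyMeasurable
  have hXm : AEStronglyMeasurable X P :=
    aestronglyMeasurable_of_tendsto_ae atTop hfm (ae_of_all _ hfX)
  have hbound : ∀ᶠ k in atTop, eLpNorm (f k) 1 P ≤ 1 + eLpNorm Y 1 P := by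
    filter_upwards [hgY.eventually_le_const (u := 1) (by simp)] with k hk
    calc eLpNorm (f k) 1 P = eLpNorm (P[g k | 𝒢 k]) 1 P := eLpNorm_congr_ae (hf k)
      _ ≤ eLpNorm (g k) 1 P := eLpNorm_condExp_le_eLpNorm _ le_rfl
      _ = eLpNorm (g k - Y + Y) 1 P := by rw [sub_add_cancel]
      _ ≤ eLpNorm (g k - Y) 1 P + eLpNorm Y 1 P :=
        eLpNorm_add_le ((hg k).sub hY).aestronglyMeasurable hY.aestronglyMeasurable le_rfl
      _ ≤ 1 + eLpNorm Y 1 P := by gcongr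
  have hX : MemLp X 1 P :=
    ⟨hXm, (Lp.eLpNorm_le_of_ae_tendsto hbound hfm (ae_of_all _ hfX)).trans_lt
      (by simpa using (memLp_one_iff_integrable.2 hY).2)⟩
  -- Split `P[g k | 𝒢 k]` as `P[Y | 𝒢 k] + P[g k - Y | 𝒢 k]`: the first family is uniformly
  -- integrable, the second tends to zero in `L¹`.
  have hui : UnifIntegrable f 1 P := by
    have h1 := (hY.uniformIntegrable_condExp h𝒢).unifIntegrable
    have h2 : UnifIntegrable (fun k => P[g k - Y | 𝒢 k]) 1 P := by
      refine unifIntegrable_of_tendsto_Lp_zero le_rfl ENNReal.one_ne_top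
        (fun k => memLp_one_iff_integrable.2 integrable_condExp) ?_
      exact tendsto_of_tendsto_of_tendsto_of_le_of_le tendsto_const_nhds hgY
        (fun _ => zero_le) (fun k => eLpNorm_condExp_le_eLpNorm _ le_rfl)
    refine (h1.add h2 le_rfl
      (fun k => integrable_condExp.aestronglyMeasurable)
      (fun k => integrable_condExp.aestronglyMeasurable)).ae_eq fun k => ?_
    filter_upwards [hf k, condExp_sub (hg k) hY (𝒢 k)] with ω h3 h4
    simp [h3, h4]
  exact ⟨memLp_one_iff_integrable.1 hX, tendsto_Lp_finite_of_tendsto_ae le_rfl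
    ENNReal.one_ne_top hfm hX hui (ae_of_all _ hfX)⟩

/-- The smallest multiple of `1 / (n + 1)` above `t`. -/
noncomputable def gridCeil (n : ℕ) (t : ℝ≥0) : ℝ≥0 := ⌈((n : ℝ≥0) + 1) * t⌉₊ / ((n : ℝ≥0) + 1)

lemma gridCeil_mono (n : ℕ) : Monotone (gridCeil n) := fun s t h => by
  unfold gridCeil; gcongr

lemma le_gridCeil (n : ℕ) (t : ℝ≥0) : t ≤ gridCeil n t := by
  rw [gridCeil, le_div_iff₀ (by positivity), mul_comm]
  exact Nat.le_ceil _

lemma gridCeil_le (n : ℕ) (t : ℝ≥0) : gridCeil n t ≤ t + 1 / ((n : ℝ≥0) + 1) := by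
  rw [gridCeil, div_le_iff₀ (by positivity), add_mul t, one_div, inv_mul_cancel₀ (by positivity),
    mul_comm t]
  exact (Nat.ceil_lt_add_one zero_le).le

lemma gridCeil_natCast (n k : ℕ) : gridCeil n k = k := by
  have : ((n : ℝ≥0) + 1) * k = ((n + 1) * k : ℕ) := by push_cast; ring
  rw [gridCeil, this, Nat.ceil_natCast, ← this, mul_comm, mul_div_assoc, div_self (by positivity),
    mul_one]

lemma tendsto_gridCeil {n : ℕ → ℕ} {t : ℕ → ℝ≥0} {s : ℝ≥0} (hn : Tendsto n atTop atTop)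
    (ht : Tendsto t atTop (𝓝 s)) : Tendsto (fun k => gridCeil (n k) (t k)) atTop (𝓝 s) := by
  have h : Tendsto (fun k => t k + 1 / ((n k : ℝ≥0) + 1)) atTop (𝓝 (s + 0)) :=
    ht.add ((tendsto_one_div_add_atTop_nhds_zero_nat (𝕜 := ℝ≥0)).comp hn)
  rw [add_zero] at h
  exact tendsto_of_tendsto_of_tendsto_of_le_of_le ht h (fun k => le_gridCeil _ _)
    (fun k => gridCeil_le _ _)

lemma gridCeil_le_iff (n : ℕ) (t s : ℝ≥0) :
    gridCeil n t ≤ s ↔ t ≤ ⌊((n : ℝ≥0) + 1) * s⌋₊ / ((n : ℝ≥0) + 1) := by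
  rw [gridCeil, div_le_iff₀ (by positivity), le_div_iff₀ (by positivity), mul_comm s,
    mul_comm t, ← Nat.le_floor_iff zero_le, Nat.ceil_le]

lemma countable_range_gridCeil (n : ℕ) (τ : Ω → ℝ≥0) :
    (Set.range fun ω => ((gridCeil n (τ ω) : ℝ≥0) : WithTop ℝ≥0)).Countable := by
  refine (Set.countable_range
    fun k : ℕ => (((k : ℝ≥0) / ((n : ℝ≥0) + 1) : ℝ≥0) : WithTop ℝ≥0)).mono ?_
  rintro _ ⟨ω, rfl⟩
  exact ⟨_, rfl⟩

variable {ℱ : Filtration ℝ≥0 m0}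

/-- The rounded time is at most `s` exactly when `min τ k` is at most the last grid point `u ≤ s`,
an event known at time `u`. -/
lemma isStoppingTime_gridCeil_min {τ : Ω → ℝ≥0}
    (hτ : IsStoppingTime ℱ fun ω => (τ ω : WithTop ℝ≥0)) (n k : ℕ) :
    IsStoppingTime ℱ fun ω => (gridCeil n (min (τ ω) k) : WithTop ℝ≥0) := by
  intro s
  set u : ℝ≥0 := ⌊((n : ℝ≥0) + 1) * s⌋₊ / ((n : ℝ≥0) + 1) with hu
  have hus : u ≤ s := by
    rw [hu, div_le_iff₀ (by positivity), mul_comm s]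
    exact Nat.floor_le zero_le
  have h := (hτ.min_const (k : ℝ≥0)) u
  refine ℱ.mono hus _ ?_
  convert h using 1
  ext ω
  simp only [Set.mem_ofPred_eq, WithTop.coe_le_coe, gridCeil_le_iff, ← WithTop.coe_min]
  rfl

/-- A continuous martingale which is uniformly integrable when stopped at the finite stopping time
`τ` is integrable at any stopping time `σ ≤ τ`, with the same mean as at time `0`. -/
theorem integrable_and_integral_eq_of_le_stopping [IsProbabilityMeasure P] {f : ℝ≥0 → Ω → ℝ}
    (hf : Martingale f ℱ P) (hcont : ∀ ω, Continuous fun t => f t ω) {σ τ : Ω → ℝ≥0}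
    (hσ : IsStoppingTime ℱ fun ω => (σ ω : WithTop ℝ≥0))
    (hτ : IsStoppingTime ℱ fun ω => (τ ω : WithTop ℝ≥0)) (hστ : ∀ ω, σ ω ≤ τ ω)
    (hui : UniformIntegrable (fun (t : ℝ≥0) ω => f (min (τ ω) t) ω) 1 P) :
    Integrable (fun ω => f (σ ω) ω) P ∧ ∫ ω, f (σ ω) ω ∂P = ∫ ω, f 0 ω ∂P := by
  have hle : ∀ (ρ : Ω → ℝ≥0) (n k : ℕ) (ω : Ω),
      (gridCeil n (min (ρ ω) k) : WithTop ℝ≥0) ≤ ((k : ℝ≥0) : WithTop ℝ≥0) := fun ρ n k ω => by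
    rw [WithTop.coe_le_coe]
    exact (gridCeil_mono n (min_le_right _ _)).trans_eq (gridCeil_natCast n k)
  have hmin : ∀ (ρ : Ω → ℝ≥0) ω, Tendsto (fun k : ℕ => min (ρ ω) (k : ℝ≥0)) atTop (𝓝 (ρ ω)) :=
    fun ρ ω => by
      refine tendsto_const_nhds.congr' ?_
      filter_upwards [(tendsto_natCast_atTop_atTop (R := ℝ≥0)).eventually_ge_atTop (ρ ω)] with k hk
      rw [min_eq_left hk]
  have hcond : ∀ {ρ : Ω → ℝ≥0} (hρ : IsStoppingTime ℱ fun ω => (ρ ω : WithTop ℝ≥0)) (n k : ℕ),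
      (fun ω => f (gridCeil n (min (ρ ω) k)) ω) =ᵐ[P]
        P[f k | (isStoppingTime_gridCeil_min hρ n k).measurableSpace] := fun hρ n k =>
    hf.stoppedValue_ae_eq_condExp_of_le_const_of_countable_range
      (isStoppingTime_gridCeil_min hρ n k) (hle _ n k) (countable_range_gridCeil n _)
  have hint : ∀ {ρ : Ω → ℝ≥0} (hρ : IsStoppingTime ℱ fun ω => (ρ ω : WithTop ℝ≥0)) (n k : ℕ),
      Integrable (fun ω => f (gridCeil n (min (ρ ω) k)) ω) P := fun hρ n k =>
    integrable_condExp.congr (hcond hρ n k).symm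
  have hbdd : ∀ k : ℕ, Integrable (fun ω => f (min (τ ω) k) ω) P ∧ Tendsto (fun n => eLpNorm
      ((fun ω => f (gridCeil n (min (τ ω) k)) ω) - fun ω => f (min (τ ω) k) ω) 1 P)
      atTop (𝓝 0) := fun k => by
    refine tendsto_eLpNorm_of_ae_eq_condExp (g := fun _ => f k) (Y := f k)
      (fun n => (isStoppingTime_gridCeil_min hτ n k).measurableSpace_le)
      (fun n => hcond hτ n k) (fun _ => hf.integrable _) (hf.integrable _) (by simp) fun ω => ?_
    exact ((hcont ω).tendsto _).comp (tendsto_gridCeil tendsto_id tendsto_const_nhds)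
  -- Diagonal choice: for each truncation level `k`, a grid fine enough that the rounding error at
  -- `τ` is at most `1 / (k + 1)` in `L¹`.
  have hex : ∀ k : ℕ, ∃ n, k ≤ n ∧ eLpNorm ((fun ω => f (gridCeil n (min (τ ω) k)) ω) -
      fun ω => f (min (τ ω) k) ω) 1 P ≤ ((k : ℝ≥0∞) + 1)⁻¹ := fun k =>
    ((eventually_ge_atTop k).and ((hbdd k).2.eventually_le_const (by simp))).exists
  choose n hkn hn using hex
  have hnt : Tendsto n atTop atTop := tendsto_atTop_mono hkn tendsto_id
  have hY : MemLp (fun ω => f (τ ω) ω) 1 P :=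
    hui.memLp_of_ae_tendsto (u := atTop) (ae_of_all _ fun ω =>
      tendsto_const_nhds.congr' (by
        filter_upwards [eventually_ge_atTop (τ ω)] with t ht
        rw [min_eq_left ht]))
  have hYt : Tendsto (fun k : ℕ => eLpNorm ((fun ω => f (min (τ ω) k) ω) -
      fun ω => f (τ ω) ω) 1 P) atTop (𝓝 0) :=
    tendsto_Lp_finite_of_tendsto_ae le_rfl ENNReal.one_ne_top (fun k => hui.1 k) hY
      (fun ε hε => let ⟨δ, hδ, h⟩ := hui.2.1 hε; ⟨δ, hδ, fun k => h k⟩)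
      (ae_of_all _ fun ω => ((hcont ω).tendsto _).comp (hmin τ ω))
  have hgt : Tendsto (fun k : ℕ => eLpNorm ((fun ω => f (gridCeil (n k) (min (τ ω) k)) ω) -
      fun ω => f (τ ω) ω) 1 P) atTop (𝓝 0) := by
    have h0 : Tendsto (fun k : ℕ => ((k : ℝ≥0∞) + 1)⁻¹) atTop (𝓝 0) := by
      have := (ENNReal.tendsto_inv_nat_nhds_zero).comp (tendsto_add_atTop_nat 1)
      simpa [Function.comp_def] using this
    have h1 := h0.add hYt
    rw [add_zero] at h1
    refine tendsto_of_tendsto_of_tendsto_of_le_of_le tendsto_const_nhds h1 (fun _ => zero_le)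
      fun k => ?_
    refine le_trans ?_ (add_le_add_left (hn k) _)
    refine (le_of_eq ?_).trans (eLpNorm_add_le ((hint hτ (n k) k).sub (hbdd k).1).1
      ((hbdd k).1.sub (memLp_one_iff_integrable.1 hY)).1 le_rfl)
    rw [sub_add_sub_cancel]
  -- Rounding `σ` and `τ` on the same grid preserves their order, so countable-range optional
  -- sampling makes the value at rounded `σ` a conditional expectation of the value at rounded `τ`.
  have hmain := tendsto_eLpNorm_of_ae_eq_condExp
    (f := fun k ω => f (gridCeil (n k) (min (σ ω) k)) ω)
    (g := fun k ω => f (gridCeil (n k) (min (τ ω) k)) ω)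
    (X := fun ω => f (σ ω) ω) (Y := fun ω => f (τ ω) ω)
    (fun k => (isStoppingTime_gridCeil_min hσ (n k) k).measurableSpace_le)
    (fun k => hf.stoppedValue_ae_eq_condExp_of_le_of_countable_range
      (isStoppingTime_gridCeil_min hτ (n k) k) (isStoppingTime_gridCeil_min hσ (n k) k)
      (fun ω => WithTop.coe_le_coe.2 (gridCeil_mono _ (min_le_min_right _ (hστ ω))))
      (hle _ _ _) (countable_range_gridCeil _ _) (countable_range_gridCeil _ _))
    (fun k => hint hτ (n k) k) (memLp_one_iff_integrable.1 hY) hgt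
    (fun ω => ((hcont ω).tendsto _).comp (tendsto_gridCeil hnt (hmin σ ω)))
  refine ⟨hmain.1, ?_⟩
  have hlim := tendsto_integral_of_L1' _ hmain.1.1
    (Eventually.of_forall fun k => hint hσ (n k) k) hmain.2
  refine tendsto_nhds_unique hlim (tendsto_const_nhds.congr fun k => ?_)
  rw [integral_congr_ae (hcond hσ (n k) k), integral_condExp]
  · have h := hf.setIntegral_eq (zero_le (a := (k : ℝ≥0))) MeasurableSet.univ
    simpa using h

end OptionalSampling

/-! ### The embedded laws -/

section EmbeddedLaw

variable {m : ℕ} {P : Measure (CanonicalSpace m)}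

lemma continuous_path (w : CanonicalSpace m) : Continuous fun t => path t w :=
  w.1.1.continuous

lemma measurable_embeddedValue (i : Fin (m + 1)) :
    Measurable (embeddedValue i : CanonicalSpace m → ℝ) := by
  have h : Measurable (Function.uncurry (path (m := m))) :=
    measurable_uncurry_of_continuous_of_measurable continuous_path measurable_path
  exact h.comp ((measurable_time i).prodMk measurable_id)

lemma isStoppingTime_time (i : Fin (m + 1)) :
    IsStoppingTime (canonicalFiltration m) fun w => (time i w : WithTop ℝ≥0) := by
  intro t
  refine (le_sup_right : _ ≤ canonicalFiltration m t) _ ?_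
  refine MeasurableSpace.measurableSet_generateFrom ⟨i, t, le_rfl, ?_⟩
  ext w
  exact WithTop.coe_le_coe

lemma IsStoppingLaw.martingale_path (h : IsStoppingLaw P) :
    Martingale path (canonicalFiltration m) P := by
  have := h.isProbabilityMeasure
  have hint : ∀ t, Integrable (path (m := m) t) P := fun t =>
    (h.isBrownian.hasLaw_eval t).hasGaussianLaw.integrable
  have hmean : ∀ t, ∫ w, path (m := m) t w ∂P = 0 := fun t => by
    rw [(h.isBrownian.hasLaw_eval t).integral_eq, integral_id_gaussianReal]
  have hmeas : ∀ t, StronglyMeasurable[canonicalFiltration m t] (path (m := m) t) := fun t => by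
    refine Measurable.stronglyMeasurable ?_
    have h1 : MeasurableSpace.comap (path (m := m) t) inferInstance ≤
        ⨆ s : ℝ≥0, ⨆ _ : s ≤ t, MeasurableSpace.comap (path s) inferInstance :=
      le_iSup₂ (f := fun (s : ℝ≥0) (_ : s ≤ t) =>
        MeasurableSpace.comap (path (m := m) s) inferInstance) t le_rfl
    exact (comap_measurable _).mono (h1.trans le_sup_left) le_rfl
  refine ⟨hmeas, fun s t hst => ?_⟩
  have hinc : Measurable fun w : CanonicalSpace m => path t w - path s w :=
    (measurable_path t).sub (measurable_path s)
  have h1 := condExp_indep_eq (μ := P) (f := fun w : CanonicalSpace m => path t w - path s w)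
    hinc.comap_le ((canonicalFiltration m).le s)
    (comap_measurable _).stronglyMeasurable (h.indep_increments s t hst)
  have h2 : (path (m := m) t) = (fun w => path t w - path s w) + path s := by ext w; simp
  have h3 := condExp_add ((hint t).sub (hint s)) (hint s) (canonicalFiltration m s)
  have h4 := condExp_of_stronglyMeasurable ((canonicalFiltration m).le s) (hmeas s) (hint s)
  rw [integral_sub (hint t) (hint s), hmean, hmean, sub_zero] at h1
  rw [h2]
  refine h3.trans ?_
  rw [h4]
  filter_upwards [h1] with w hw
  have hw' : (P[path t - path s | canonicalFiltration m s]) w = 0 := hw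
  simp [hw']

theorem IsStoppingLaw.integrable_and_integral_embeddedValue (h : IsStoppingLaw P)
    (i : Fin (m + 1)) :
    Integrable (embeddedValue i) P ∧ ∫ w, embeddedValue i w ∂P = 0 := by
  have := h.isProbabilityMeasure
  have h1 := integrable_and_integral_eq_of_le_stopping h.martingale_path continuous_path
    (isStoppingTime_time i) (isStoppingTime_time (Fin.last m))
    (fun w => w.2.2 (Fin.le_last i)) h.uniformIntegrable
  refine ⟨h1.1, h1.2.trans ?_⟩
  simp [path, fun w : CanonicalSpace m => w.1.2]

end EmbeddedLaw

end CallEmbedding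

namespace CallEmbedding

/-! ### Call functions on the line -/

/-- The call function `x ↦ ∫ (y - x)⁺ dμ(y)`. -/
noncomputable def callFun (μ : Measure ℝ) (x : ℝ) : ℝ := ∫ y, max (y - x) 0 ∂μ

/-- Markov's inequality for call and put payoffs. -/
lemma integral_max_sub_le {μ : Measure ℝ} {p a : ℝ} (hp : 1 ≤ p) (ha : 0 < a) {g : ℝ → ℝ} (hg : ∀ y, |g y| = |y|)
    (hint : Integrable (fun y : ℝ => |y| ^ p) μ) :
    ∫ y, max (g y - a) 0 ∂μ ≤ (∫ y, |y| ^ p ∂μ) * a ^ (1 - p) := by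
  rw [← integral_mul_const]
  refine integral_mono_of_nonneg (ae_of_all _ fun y => le_max_right _ _) (hint.mul_const _)
    (ae_of_all _ fun y => ?_)
  have h0 : 0 ≤ |y| ^ p * a ^ (1 - p) := by positivity
  refine max_le ?_ h0
  rcases le_or_gt (g y) a with h | h
  · linarith
  have hy : a ≤ |y| := by rw [← hg]; exact h.le.trans (le_abs_self _)
  have hy0 : 0 < |y| := ha.trans_le hy
  have h1 : |y| ^ (1 - p) ≤ a ^ (1 - p) := Real.rpow_le_rpow_of_nonpos ha hy (by linarith)
  calc g y - a ≤ |y| := by rw [← hg]; linarith [le_abs_self (g y)]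
    _ = |y| ^ p * |y| ^ (1 - p) := by rw [← Real.rpow_add hy0]; simp
    _ ≤ |y| ^ p * a ^ (1 - p) := by gcongr

section CallFun

variable {μ ν : Measure ℝ} [IsProbabilityMeasure μ] [IsProbabilityMeasure ν]

lemma integrable_call (hμ : Integrable (fun y : ℝ => y) μ) (x : ℝ) :
    Integrable (fun y => max (y - x) 0) μ :=
  (hμ.sub (integrable_const x)).pos_part

lemma callFun_nonneg (μ : Measure ℝ) (x : ℝ) : 0 ≤ callFun μ x :=
  integral_nonneg fun _ => le_max_right _ _

/-- The put-call parity for a centered law. -/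
lemma callFun_add_eq (hμ : Integrable (fun y : ℝ => y) μ) (h0 : ∫ y, y ∂μ = 0) (x : ℝ) :
    callFun μ x + x = ∫ y, max (x - y) 0 ∂μ := by
  have h : ∀ y : ℝ, max (x - y) 0 = max (y - x) 0 - (y - x) := fun y => by
    rcases le_total x y with h | h
    · rw [max_eq_right (by linarith), max_eq_left (by linarith)]; ring
    · rw [max_eq_left (by linarith), max_eq_right (by linarith)]; ring
  have hsub : Integrable (fun y => y - x) μ := hμ.sub (integrable_const x)
  simp_rw [h]
  rw [integral_sub (integrable_call hμ x) hsub, integral_sub hμ (integrable_const x), h0, callFun]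
  simp

lemma callFun_add_nonneg (hμ : Integrable (fun y : ℝ => y) μ) (h0 : ∫ y, y ∂μ = 0) (x : ℝ) :
    0 ≤ callFun μ x + x := by
  rw [callFun_add_eq hμ h0]
  exact integral_nonneg fun _ => le_max_right _ _

lemma integral_indicator_Ioi_const (c x : ℝ) :
    ∫ y, (Set.Ioi x).indicator (fun _ => c) y ∂μ = c * (1 - cdf μ x) := by
  rw [integral_indicator_const _ measurableSet_Ioi, smul_eq_mul, mul_comm, cdf_eq_real,
    ← probReal_compl_eq_one_sub measurableSet_Iic, Set.compl_Iic]

/-- The payoff difference `(y - x)⁺ - (y - z)⁺` lies between `(z - x) 1_{y > z}` and `(z - x) 1_{y >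
x}`. The upper bound is used here, the lower one in `le_callFun_sub`. -/
lemma callFun_sub_le (hμ : Integrable (fun y : ℝ => y) μ) {x z : ℝ} (hxz : x ≤ z) :
    callFun μ x - callFun μ z ≤ (z - x) * (1 - cdf μ x) := by
  rw [callFun, callFun, ← integral_sub (integrable_call hμ x) (integrable_call hμ z),
    ← integral_indicator_Ioi_const]
  refine integral_mono ((integrable_call hμ x).sub (integrable_call hμ z))
    ((integrable_const _).indicator measurableSet_Ioi) fun y => ?_
  by_cases hy : y ∈ Set.Ioi x
  · have hy' : x < y := hy
    simp only [Set.indicator_of_mem hy, max_eq_left (sub_nonneg.2 hy'.le)]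
    linarith [le_max_left (y - z) 0]
  · have hy' : y ≤ x := not_lt.1 hy
    simp [hy', hy'.trans hxz]

lemma le_callFun_sub (hμ : Integrable (fun y : ℝ => y) μ) {x z : ℝ} (hxz : x ≤ z) :
    (z - x) * (1 - cdf μ z) ≤ callFun μ x - callFun μ z := by
  rw [callFun, callFun, ← integral_sub (integrable_call hμ x) (integrable_call hμ z),
    ← integral_indicator_Ioi_const]
  refine integral_mono ((integrable_const _).indicator measurableSet_Ioi)
    ((integrable_call hμ x).sub (integrable_call hμ z)) fun y => ?_
  by_cases hy : y ∈ Set.Ioi z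
  · have hy' : z < y := hy
    simp only [Set.indicator_of_mem hy, max_eq_left (sub_nonneg.2 hy'.le),
      max_eq_left (sub_nonneg.2 (hxz.trans hy'.le))]
    linarith
  · rw [Set.indicator_of_notMem hy]
    exact sub_nonneg.2 (max_le_max_right _ (by linarith))

lemma callFun_antitone (hμ : Integrable (fun y : ℝ => y) μ) : Antitone (callFun μ) :=
  fun x z hxz => by
    have h := le_callFun_sub hμ hxz
    have := mul_nonneg (sub_nonneg.2 hxz) (sub_nonneg.2 (cdf_le_one μ z))
    linarith

/-- The put function `x ↦ callFun μ x + x` of a centered law is monotone. -/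
lemma callFun_add_mono (hμ : Integrable (fun y : ℝ => y) μ) :
    Monotone fun x => callFun μ x + x := fun x z hxz => by
  have h := callFun_sub_le hμ hxz
  have := mul_nonneg (sub_nonneg.2 hxz) (cdf_nonneg μ x)
  simp only
  nlinarith

/-- Uniformly close call functions have close distribution functions. -/
lemma cdf_le_cdf_add (hμ : Integrable (fun y : ℝ => y) μ) (hν : Integrable (fun y : ℝ => y) ν)
    {η ε : ℝ} (h : ∀ x, |callFun μ x - callFun ν x| ≤ η) (hε : 0 < ε) (hηε : 2 * η ≤ ε ^ 2)
    (x : ℝ) : cdf μ x ≤ cdf ν (x + ε) + ε := by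
  have hx : x ≤ x + ε := by linarith
  have h1 := callFun_sub_le hμ hx
  have h2 := le_callFun_sub hν hx
  have h3 := abs_le.1 (h x)
  have h4 := abs_le.1 (h (x + ε))
  rw [add_sub_cancel_left] at h1 h2
  -- The increments of the two call functions over `[x, x + ε]` differ by at most `2 * η ≤ ε ^ 2`.
  have h5 : ε * (cdf μ x) ≤ ε * (cdf ν (x + ε) + ε) := by nlinarith
  exact le_of_mul_le_mul_left h5 hε

lemma levyDist_le (hμ : Integrable (fun y : ℝ => y) μ) (hν : Integrable (fun y : ℝ => y) ν)
    {η ε : ℝ} (h : ∀ x, |callFun μ x - callFun ν x| ≤ η) (hε : 0 < ε) (hηε : 2 * η ≤ ε ^ 2) :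
    levyDist μ ν ≤ ε := by
  refine csInf_le ⟨0, fun e he => he.1.le⟩ ⟨hε, fun x => ⟨?_, ?_⟩⟩
  · have := cdf_le_cdf_add hμ hν h hε hηε (x - ε)
    rw [sub_add_cancel] at this
    linarith
  · exact cdf_le_cdf_add hν hμ (fun y => by rw [abs_sub_comm]; exact h y) hε hηε x

/-- Centered laws with the same call prices at all strikes of a grid have close call functions. -/
lemma abs_callFun_sub_le (hμ : Integrable (fun y : ℝ => y) μ) (hμ0 : ∫ y, y ∂μ = 0)
    (hν : Integrable (fun y : ℝ => y) ν) (hν0 : ∫ y, y ∂ν = 0) {n : ℕ} {K : Fin (n + 1) → ℝ}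
    (heq : ∀ j, callFun ν (K j) = callFun μ (K j)) {δ h : ℝ} (hδ0 : 0 ≤ δ)
    (hδ : ∀ i : Fin n, K i.succ - K i.castSucc ≤ δ) (hlast : callFun μ (K (Fin.last n)) ≤ h)
    (hzero : callFun μ (K 0) + K 0 ≤ h) (x : ℝ) : |callFun μ x - callFun ν x| ≤ δ + h := by
  have hh : 0 ≤ h := (callFun_nonneg μ _).trans hlast
  -- Left of the strikes both put functions lie between `0` and their common value at `K 0`; right
  -- of them the same holds for calls at the last strike.
  rcases le_or_gt x (K 0) with hx | hx
  · have h1 := callFun_add_mono hμ hx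
    have h2 := callFun_add_mono hν hx
    have h3 := callFun_add_nonneg hμ hμ0 x
    have h4 := callFun_add_nonneg hν hν0 x
    simp only [heq] at h1 h2
    rw [abs_le]
    constructor <;> linarith
  rcases le_or_gt (K (Fin.last n)) x with hx' | hx'
  · have h1 := callFun_antitone hμ hx'
    have h2 := callFun_antitone hν hx'
    have h3 := callFun_nonneg μ x
    have h4 := callFun_nonneg ν x
    rw [heq] at h2
    rw [abs_le]
    constructor <;> linarith
  -- The induction locates the cell containing `x`. There both values lie between the common prices
  -- at its ends, which differ by at most the gap because the put function is monotone.
  suffices H : ∀ j, x ≤ K j → |callFun μ x - callFun ν x| ≤ δ by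
    linarith [H (Fin.last n) hx'.le]
  intro j
  induction j using Fin.induction with
  | zero => intro h'; linarith
  | succ i ih =>
    intro hi
    rcases le_or_gt x (K i.castSucc) with h' | h'
    · exact ih h'
    have h1 := callFun_antitone hμ hi
    have h2 := callFun_antitone hν hi
    have h3 := callFun_antitone hμ h'.le
    have h4 := callFun_antitone hν h'.le
    have h5 := callFun_add_mono hμ (h'.le.trans hi)
    have h6 := hδ i
    simp only [heq] at h2 h4 h5
    rw [abs_le]
    constructor <;> linarith

lemma integral_abs_le {p : ℝ} (hp : 1 ≤ p) (hint : Integrable (fun y : ℝ => |y| ^ p) μ) :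
    ∫ y, |y| ∂μ ≤ 1 + ∫ y, |y| ^ p ∂μ := by
  have h : ∫ y, (1 + |y| ^ p) ∂μ = 1 + ∫ y, |y| ^ p ∂μ := by
    rw [integral_add (integrable_const _) hint]; simp
  rw [← h]
  refine integral_mono_of_nonneg (ae_of_all _ fun y => abs_nonneg _)
    ((integrable_const _).add hint) (ae_of_all _ fun y => ?_)
  have h0 : 0 ≤ |y| ^ p := by positivity
  rcases le_or_gt |y| 1 with h1 | h1
  · simp only; linarith
  · have := Real.rpow_le_rpow_of_exponent_le h1.le hp
    rw [Real.rpow_one] at this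
    simp only; linarith

/-- Expresses the first moment through a call price, which bounds that of the embedded law without
any assumption on its `p`-th moment. -/
lemma integral_abs_eq (hμ : Integrable (fun y : ℝ => y) μ) (h0 : ∫ y, y ∂μ = 0) :
    ∫ y, |y| ∂μ = 2 * callFun μ 0 := by
  have h : ∀ y : ℝ, |y| = 2 * max (y - 0) 0 - y := fun y => by
    rcases le_total 0 y with h | h
    · rw [abs_of_nonneg h, max_eq_left (by linarith)]; ring
    · rw [abs_of_nonpos h, max_eq_right (by linarith)]; ring
  simp_rw [h]
  rw [integral_sub ((integrable_call hμ 0).const_mul 2) hμ, h0, integral_const_mul, sub_zero,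
    callFun]

end CallFun

end CallEmbedding

namespace CallEmbedding

/-! ### The quantile coupling and the Wasserstein distance -/

section Wasserstein

open Set Filter Topology

/-- The quantile function of a measure on the line. -/
noncomputable def quantile (μ : Measure ℝ) (u : ℝ) : ℝ := sInf {x | u ≤ cdf μ x}

/-- For `u` in `(0, 1)` the set defining the infimum is nonempty and bounded below; right continuity
of the distribution function makes the infimum attained. -/
lemma quantile_le_iff (μ : Measure ℝ) {u : ℝ} (hu : u ∈ Ioo (0 : ℝ) 1) (x : ℝ) :
    quantile μ u ≤ x ↔ u ≤ cdf μ x := by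
  have hne : {x | u ≤ cdf μ x}.Nonempty :=
    ((tendsto_cdf_atTop μ).eventually (eventually_ge_nhds hu.2)).exists
  obtain ⟨b, hb⟩ := ((tendsto_cdf_atBot μ).eventually (eventually_lt_nhds hu.1)).exists
  have hbdd : BddBelow {x | u ≤ cdf μ x} := ⟨b, fun x hx => by
    by_contra! h
    exact absurd (hx.trans (monotone_cdf μ h.le)) (not_le.2 hb)⟩
  refine ⟨fun h => ?_, fun h => csInf_le hbdd h⟩
  have hcont : Tendsto (cdf μ) (𝓝[>] x) (𝓝 (cdf μ x)) :=
    ((cdf μ).right_continuous x).mono Ioi_subset_Ici_self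
  refine ge_of_tendsto hcont ?_
  filter_upwards [self_mem_nhdsWithin] with y hy
  obtain ⟨z, hz, hzy⟩ := (csInf_lt_iff hbdd hne).1 (lt_of_le_of_lt h hy)
  exact le_trans hz (monotone_cdf μ hzy.le)

lemma aemeasurable_quantile (μ : Measure ℝ) :
    AEMeasurable (quantile μ) (volume.restrict (Ioo 0 1)) := by
  refine aemeasurable_restrict_of_monotoneOn measurableSet_Ioo fun u hu v hv huv => ?_
  rw [quantile_le_iff μ hu]
  exact huv.trans ((quantile_le_iff μ hv _).1 le_rfl)

lemma map_quantile (μ : Measure ℝ) [IsProbabilityMeasure μ] :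
    (volume.restrict (Ioo 0 1)).map (quantile μ) = μ := by
  have : IsFiniteMeasure (volume.restrict (Ioo (0 : ℝ) 1)) := ⟨by simp⟩
  refine Measure.ext_of_Iic _ _ fun x => ?_
  rw [Measure.map_apply_of_aemeasurable (aemeasurable_quantile μ) measurableSet_Iic,
    ← ofReal_cdf μ x]
  have h : quantile μ ⁻¹' Iic x ∩ Ioo 0 1 = Iic (cdf μ x) ∩ Ioo 0 1 := by
    ext u
    constructor
    · exact fun h => ⟨(quantile_le_iff μ h.2 x).1 h.1, h.2⟩
    · exact fun h => ⟨(quantile_le_iff μ h.2 x).2 h.1, h.2⟩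
  rw [Measure.restrict_apply₀' measurableSet_Ioo.nullMeasurableSet, h]
  refine le_antisymm ?_ ?_
  · calc volume (Iic (cdf μ x) ∩ Ioo 0 1) ≤ volume (Ioc 0 (cdf μ x)) :=
        measure_mono fun u hu => ⟨hu.2.1, hu.1⟩
      _ = _ := by simp
  · calc ENNReal.ofReal (cdf μ x) = volume (Ioo 0 (cdf μ x)) := by simp
      _ ≤ volume (Iic (cdf μ x) ∩ Ioo 0 1) :=
        measure_mono fun u hu => ⟨hu.2.le, hu.1, hu.2.trans_le (cdf_le_one μ x)⟩

/-- Fubini's theorem for the measure of a subset of a product. -/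
lemma lintegral_measure_slice {α β : Type*} [MeasurableSpace α] [MeasurableSpace β]
    (μ : Measure α) (ν : Measure β) [SFinite μ] [SFinite ν] {S : Set (α × β)}
    (hS : MeasurableSet S) :
    ∫⁻ a, ν {b | (a, b) ∈ S} ∂μ = ∫⁻ b, μ {a | (a, b) ∈ S} ∂ν :=
  (Measure.prod_apply hS).symm.trans (Measure.prod_apply_symm hS)

/-- Fubini for the region `S` between the two graphs: its slice at level `u` contains the interval
between the quantiles, and its slice at `x` lies in the interval between the distribution functions.
-/
lemma wassersteinDist_le_lintegral_cdf (μ ν : Measure ℝ) [IsProbabilityMeasure μ]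
    [IsProbabilityMeasure ν] :
    wassersteinDist μ ν ≤ ∫⁻ x, ENNReal.ofReal |cdf μ x - cdf ν x| := by
  have hm := aemeasurable_quantile μ
  have hn := aemeasurable_quantile ν
  refine iInf₂_le_of_le ((volume.restrict (Ioo 0 1)).map fun u => (quantile μ u, quantile ν u))
    ⟨?_, ?_⟩ ?_
  · rw [AEMeasurable.map_map_of_aemeasurable measurable_fst.aemeasurable (hm.prodMk hn)]
    exact map_quantile μ
  · rw [AEMeasurable.map_map_of_aemeasurable measurable_snd.aemeasurable (hm.prodMk hn)]
    exact map_quantile ν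
  rw [lintegral_map' (by fun_prop) (hm.prodMk hn)]
  have hF := (monotone_cdf μ).measurable
  have hG := (monotone_cdf ν).measurable
  let S : Set (ℝ × ℝ) := {z | cdf ν z.2 < z.1 ∧ z.1 ≤ cdf μ z.2} ∪
    {z | cdf μ z.2 < z.1 ∧ z.1 ≤ cdf ν z.2}
  have hS : MeasurableSet S :=
    ((measurableSet_lt (hG.comp measurable_snd) measurable_fst).inter
      (measurableSet_le measurable_fst (hF.comp measurable_snd))).union
    ((measurableSet_lt (hF.comp measurable_snd) measurable_fst).inter
      (measurableSet_le measurable_fst (hG.comp measurable_snd)))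
  calc ∫⁻ u in Ioo 0 1, ENNReal.ofReal |quantile μ u - quantile ν u|
      ≤ ∫⁻ u in Ioo 0 1, volume {x | (u, x) ∈ S} := by
        refine setLIntegral_mono' measurableSet_Ioo fun u hu => ?_
        rcases le_total (quantile μ u) (quantile ν u) with h | h
        · rw [abs_sub_comm, abs_of_nonneg (sub_nonneg.2 h), ← Real.volume_Ico]
          refine measure_mono fun x hx => Or.inl ⟨?_, (quantile_le_iff μ hu x).1 hx.1⟩
          exact not_le.1 fun h' => not_le.2 hx.2 ((quantile_le_iff ν hu x).2 h')
        · rw [abs_of_nonneg (sub_nonneg.2 h), ← Real.volume_Ico]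
          refine measure_mono fun x hx => Or.inr ⟨?_, (quantile_le_iff ν hu x).1 hx.1⟩
          exact not_le.1 fun h' => not_le.2 hx.2 ((quantile_le_iff μ hu x).2 h')
    _ = ∫⁻ x, volume.restrict (Ioo 0 1) {u | (u, x) ∈ S} := lintegral_measure_slice _ _ hS
    _ ≤ ∫⁻ x, ENNReal.ofReal |cdf μ x - cdf ν x| := by
        refine lintegral_mono fun x => (Measure.restrict_apply_le _ _).trans ?_
        have hsub : {u | (u, x) ∈ S} ⊆
            Ioc (min (cdf μ x) (cdf ν x)) (max (cdf μ x) (cdf ν x)) := by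
          rintro u (⟨h1, h2⟩ | ⟨h1, h2⟩)
          · exact ⟨(min_le_right _ _).trans_lt h1, h2.trans (le_max_left _ _)⟩
          · exact ⟨(min_le_left _ _).trans_lt h1, h2.trans (le_max_right _ _)⟩
        refine (measure_mono hsub).trans_eq ?_
        rw [Real.volume_Ioc, max_sub_min_eq_abs']

lemma lintegral_max_sub (μ : Measure ℝ) [IsProbabilityMeasure μ]
    (hμ : Integrable (fun y : ℝ => y) μ) (a : ℝ) :
    ∫⁻ y, ENNReal.ofReal (y - a) ∂μ = ENNReal.ofReal (callFun μ a) := by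
  rw [callFun, ofReal_integral_eq_lintegral_ofReal (integrable_call hμ a)
    (ae_of_all _ fun y => le_max_right _ _)]
  refine lintegral_congr fun y => ?_
  rw [ENNReal.ofReal_max]; simp

lemma lintegral_max_sub' (μ : Measure ℝ) [IsProbabilityMeasure μ]
    (hμ : Integrable (fun y : ℝ => y) μ) (h0 : ∫ y, y ∂μ = 0) (a : ℝ) :
    ∫⁻ y, ENNReal.ofReal (a - y) ∂μ = ENNReal.ofReal (callFun μ a + a) := by
  have hint : Integrable (fun y => max (a - y) 0) μ := ((integrable_const a).sub hμ).pos_part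
  rw [callFun_add_eq hμ h0, ofReal_integral_eq_lintegral_ofReal hint
    (ae_of_all _ fun y => le_max_right _ _)]
  refine lintegral_congr fun y => ?_
  rw [ENNReal.ofReal_max]; simp

lemma lintegral_Ioi_cdf (μ : Measure ℝ) [IsProbabilityMeasure μ]
    (hμ : Integrable (fun y : ℝ => y) μ) (a : ℝ) :
    ∫⁻ x in Ioi a, ENNReal.ofReal (1 - cdf μ x) ≤ ENNReal.ofReal (callFun μ a) := by
  have hS : MeasurableSet {z : ℝ × ℝ | z.1 < z.2} := measurableSet_lt measurable_fst measurable_snd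
  calc ∫⁻ x in Ioi a, ENNReal.ofReal (1 - cdf μ x)
      = ∫⁻ x in Ioi a, μ {y | (x, y) ∈ {z : ℝ × ℝ | z.1 < z.2}} := by
        refine lintegral_congr fun x => ?_
        rw [cdf_eq_real, ← probReal_compl_eq_one_sub measurableSet_Iic, Set.compl_Iic,
          ofReal_measureReal]
        rfl
    _ = ∫⁻ y, volume.restrict (Ioi a) {x | (x, y) ∈ {z : ℝ × ℝ | z.1 < z.2}} ∂μ :=
        lintegral_measure_slice _ _ hS
    _ ≤ ∫⁻ y, ENNReal.ofReal (y - a) ∂μ := by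
        refine lintegral_mono fun y => ?_
        rw [Measure.restrict_apply' measurableSet_Ioi, ← Real.volume_Ioo]
        exact measure_mono fun x hx => ⟨hx.2, hx.1⟩
    _ = _ := lintegral_max_sub μ hμ a

lemma lintegral_Iic_cdf (μ : Measure ℝ) [IsProbabilityMeasure μ]
    (hμ : Integrable (fun y : ℝ => y) μ) (h0 : ∫ y, y ∂μ = 0) (a : ℝ) :
    ∫⁻ x in Iic a, ENNReal.ofReal (cdf μ x) ≤ ENNReal.ofReal (callFun μ a + a) := by
  have hS : MeasurableSet {z : ℝ × ℝ | z.2 ≤ z.1} := measurableSet_le measurable_snd measurable_fst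
  calc ∫⁻ x in Iic a, ENNReal.ofReal (cdf μ x)
      = ∫⁻ x in Iic a, μ {y | (x, y) ∈ {z : ℝ × ℝ | z.2 ≤ z.1}} := by
        refine lintegral_congr fun x => ?_
        rw [ofReal_cdf]
        rfl
    _ = ∫⁻ y, volume.restrict (Iic a) {x | (x, y) ∈ {z : ℝ × ℝ | z.2 ≤ z.1}} ∂μ :=
        lintegral_measure_slice _ _ hS
    _ ≤ ∫⁻ y, ENNReal.ofReal (a - y) ∂μ := by
        refine lintegral_mono fun y => ?_
        rw [Measure.restrict_apply' measurableSet_Iic, ← Real.volume_Icc]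
        exact measure_mono fun x hx => ⟨hx.1, hx.2⟩
    _ = _ := lintegral_max_sub' μ hμ h0 a

/-- By Fubini: each `y` lies in the window `(x - ε, x + ε]` for a set of `x` of length `2 * ε`. -/
lemma lintegral_cdf_sub_cdf (μ : Measure ℝ) [IsProbabilityMeasure μ] (ε : ℝ) :
    ∫⁻ x, ENNReal.ofReal (cdf μ (x + ε) - cdf μ (x - ε)) ≤ ENNReal.ofReal (2 * ε) := by
  have hS : MeasurableSet {z : ℝ × ℝ | z.1 - ε < z.2 ∧ z.2 ≤ z.1 + ε} :=
    (measurableSet_lt (measurable_fst.sub_const ε) measurable_snd).inter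
      (measurableSet_le measurable_snd (measurable_fst.add_const ε))
  calc ∫⁻ x, ENNReal.ofReal (cdf μ (x + ε) - cdf μ (x - ε))
      = ∫⁻ x, μ {y | (x, y) ∈ {z : ℝ × ℝ | z.1 - ε < z.2 ∧ z.2 ≤ z.1 + ε}} := by
        refine lintegral_congr fun x => ?_
        rw [← (cdf μ).measure_Ioc, measure_cdf]
        rfl
    _ = ∫⁻ y, volume {x | (x, y) ∈ {z : ℝ × ℝ | z.1 - ε < z.2 ∧ z.2 ≤ z.1 + ε}} ∂μ :=
        lintegral_measure_slice _ _ hS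
    _ ≤ ∫⁻ _, ENNReal.ofReal (2 * ε) ∂μ := by
        refine lintegral_mono fun y => ?_
        have : ENNReal.ofReal (2 * ε) = volume (Ico (y - ε) (y + ε)) := by
          rw [Real.volume_Ico]; ring_nf
        rw [this]
        exact measure_mono fun x hx => ⟨by linarith [hx.2], by linarith [hx.1]⟩
    _ = _ := by simp

/-- The Wasserstein distance of centered laws with close distribution functions. -/
lemma wassersteinDist_le_of_cdf {μ ν : Measure ℝ} [IsProbabilityMeasure μ]
    [IsProbabilityMeasure ν] (hμ : Integrable (fun y : ℝ => y) μ) (hμ0 : ∫ y, y ∂μ = 0)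
    (hν : Integrable (fun y : ℝ => y) ν) (hν0 : ∫ y, y ∂ν = 0) {a ε : ℝ} (ha : 0 ≤ a)
    (hε : 0 ≤ ε) (h1 : ∀ x, cdf μ x ≤ cdf ν (x + ε) + ε)
    (h2 : ∀ x, cdf ν x ≤ cdf μ (x + ε) + ε) :
    wassersteinDist μ ν ≤ ENNReal.ofReal ((callFun μ a + callFun ν a) +
      ((callFun μ (-a) + -a) + (callFun ν (-a) + -a)) + (2 * ε + 2 * a * ε)) := by
  have hF := (monotone_cdf μ).measurable
  have hG := (monotone_cdf ν).measurable
  have hc : ∀ x, |cdf μ x - cdf ν x| ≤ (cdf μ (x + ε) - cdf μ (x - ε)) + ε := fun x => by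
    have h3 := h1 (x - ε)
    rw [sub_add_cancel] at h3
    have h4 := monotone_cdf μ (show x ≤ x + ε by linarith)
    have h5 := monotone_cdf μ (show x - ε ≤ x by linarith)
    rw [abs_le]
    constructor <;> linarith [h2 x]
  have hr : ∫⁻ x in Ioi a, ENNReal.ofReal |cdf μ x - cdf ν x| ≤
      ENNReal.ofReal (callFun μ a + callFun ν a) := by
    rw [ENNReal.ofReal_add (callFun_nonneg _ _) (callFun_nonneg _ _)]
    refine le_trans ?_ (add_le_add (lintegral_Ioi_cdf μ hμ a) (lintegral_Ioi_cdf ν hν a))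
    rw [← lintegral_add_left (by fun_prop)]
    refine lintegral_mono fun x => ?_
    rw [← ENNReal.ofReal_add (sub_nonneg.2 (cdf_le_one _ _)) (sub_nonneg.2 (cdf_le_one _ _))]
    refine ENNReal.ofReal_le_ofReal ?_
    rw [abs_le]
    constructor <;> linarith [cdf_le_one μ x, cdf_le_one ν x]
  have hl : ∫⁻ x in Iic (-a), ENNReal.ofReal |cdf μ x - cdf ν x| ≤
      ENNReal.ofReal ((callFun μ (-a) + -a) + (callFun ν (-a) + -a)) := by
    rw [ENNReal.ofReal_add (callFun_add_nonneg hμ hμ0 _) (callFun_add_nonneg hν hν0 _)]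
    refine le_trans ?_ (add_le_add (lintegral_Iic_cdf μ hμ hμ0 _) (lintegral_Iic_cdf ν hν hν0 _))
    rw [← lintegral_add_left (by fun_prop)]
    refine lintegral_mono fun x => ?_
    rw [← ENNReal.ofReal_add (cdf_nonneg _ _) (cdf_nonneg _ _)]
    refine ENNReal.ofReal_le_ofReal ?_
    rw [abs_le]
    constructor <;> linarith [cdf_nonneg μ x, cdf_nonneg ν x]
  have hm : ∫⁻ x in Ioc (-a) a, ENNReal.ofReal |cdf μ x - cdf ν x| ≤
      ENNReal.ofReal (2 * ε + 2 * a * ε) := by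
    rw [ENNReal.ofReal_add (by positivity) (by positivity)]
    calc ∫⁻ x in Ioc (-a) a, ENNReal.ofReal |cdf μ x - cdf ν x|
        ≤ ∫⁻ x in Ioc (-a) a,
            (ENNReal.ofReal (cdf μ (x + ε) - cdf μ (x - ε)) + ENNReal.ofReal ε) :=
          lintegral_mono fun x =>
            (ENNReal.ofReal_le_ofReal (hc x)).trans ENNReal.ofReal_add_le
      _ = (∫⁻ x in Ioc (-a) a, ENNReal.ofReal (cdf μ (x + ε) - cdf μ (x - ε))) +
            ∫⁻ _ in Ioc (-a) a, ENNReal.ofReal ε := lintegral_add_right _ measurable_const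
      _ ≤ _ := by
          refine add_le_add ((setLIntegral_le_lintegral _ _).trans (lintegral_cdf_sub_cdf μ ε)) ?_
          rw [setLIntegral_const, Real.volume_Ioc, ← ENNReal.ofReal_mul hε]
          exact ENNReal.ofReal_le_ofReal (by linarith)
  have h3 := callFun_nonneg μ a
  have h4 := callFun_nonneg ν a
  have h5 := callFun_add_nonneg hμ hμ0 (-a)
  have h6 := callFun_add_nonneg hν hν0 (-a)
  rw [ENNReal.ofReal_add (by linarith) (by positivity), ENNReal.ofReal_add (by linarith)
    (by linarith)]
  refine (wassersteinDist_le_lintegral_cdf μ ν).trans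
    (le_trans ?_ (add_le_add (add_le_add hr hl) hm))
  rw [← setLIntegral_univ, ← Iic_union_Ioi (a := -a), ← Ioc_union_Ioi_eq_Ioi (by linarith : -a ≤ a)]
  refine (lintegral_union_le _ _ _).trans ?_
  refine (add_le_add_right (lintegral_union_le _ _ _) _).trans_eq ?_
  ring

lemma wassersteinDist_le_integral_abs {μ ν : Measure ℝ} [IsProbabilityMeasure μ]
    [IsProbabilityMeasure ν] (hμ : Integrable (fun y : ℝ => y) μ)
    (hν : Integrable (fun y : ℝ => y) ν) :
    wassersteinDist μ ν ≤ ENNReal.ofReal (∫ y, |y| ∂μ + ∫ y, |y| ∂ν) := by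
  refine iInf₂_le_of_le (μ.prod ν) ⟨by simp, by simp⟩ ?_
  have hm : Measurable fun y : ℝ => ENNReal.ofReal |y| := by fun_prop
  calc ∫⁻ z, ENNReal.ofReal |z.1 - z.2| ∂(μ.prod ν)
      ≤ ∫⁻ z, (ENNReal.ofReal |z.1| + ENNReal.ofReal |z.2|) ∂(μ.prod ν) :=
        lintegral_mono fun z =>
          (ENNReal.ofReal_le_ofReal (abs_sub _ _)).trans ENNReal.ofReal_add_le
    _ = (∫⁻ y, ENNReal.ofReal |y| ∂μ) + ∫⁻ y, ENNReal.ofReal |y| ∂ν := by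
        rw [lintegral_add_left (by fun_prop),
          measurePreserving_fst.lintegral_comp hm, measurePreserving_snd.lintegral_comp hm]
    _ = _ := by
        rw [ENNReal.ofReal_add (integral_nonneg fun _ => abs_nonneg _)
          (integral_nonneg fun _ => abs_nonneg _),
          ofReal_integral_eq_lintegral_ofReal hμ.abs (ae_of_all _ fun _ => abs_nonneg _),
          ofReal_integral_eq_lintegral_ofReal hν.abs (ae_of_all _ fun _ => abs_nonneg _)]

end Wasserstein

end CallEmbedding

/-! ### The Lévy and Wasserstein bounds -/

namespace CallEmbedding

/-- Bounds on the distances of two centered laws on the line with the same call prices. -/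
theorem levyDist_wassersteinDist_le {μ ν : Measure ℝ} [IsProbabilityMeasure μ]
    [IsProbabilityMeasure ν] (hμ : Integrable (fun y : ℝ => y) μ) (hμ0 : ∫ y, y ∂μ = 0)
    (hν : Integrable (fun y : ℝ => y) ν) (hν0 : ∫ y, y ∂ν = 0) {p q V : ℝ}
    (hpq : p.HolderConjugate q) (hint : Integrable (fun x : ℝ => |x| ^ p) μ)
    (hV : ∫ x, |x| ^ p ∂μ ≤ V) {n : ℕ} {K : Fin (n + 1) → ℝ} (hK : StrictMono K)
    (hpos : 0 < strikeBound K) (heq : ∀ j, callFun ν (K j) = callFun μ (K j)) :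
    levyDist μ ν ≤ (20 * (1 + V)) * (√(mesh K) + strikeBound K ^ (-(p / (2 * q)))) ∧
      (1 ≤ strikeBound K ∨ 3 ≤ p → wassersteinDist μ ν ≤
        ENNReal.ofReal ((20 * (1 + V)) * strikeBound K *
          (√(mesh K) + strikeBound K ^ (-(p / (2 * q)))))) := by
  have hp : 1 < p := hpq.lt
  have hV0 : 0 ≤ V := (integral_nonneg fun x => by positivity).trans hV
  set a := strikeBound K with ha
  set δ := mesh K with hδ
  set s := a ^ (-(p / (2 * q))) with hs
  -- Conjugacy gives `p / q = p - 1`, so `s ^ 2` is the Markov factor `a ^ (1 - p)`.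
  have hexp : -(p / (2 * q)) = (1 - p) / 2 := by
    rw [hpq.conjugate_eq]
    have : p - 1 ≠ 0 := by linarith
    field_simp
    ring
  have hs0 : 0 < s := Real.rpow_pos_of_pos hpos _
  have hs2 : a ^ (1 - p) = s ^ 2 := by
    rw [hs, hexp, ← Real.rpow_natCast, ← Real.rpow_mul hpos.le]
    congr 1
    push_cast
    ring
  have hK0 : a ≤ -(K 0) := by
    by_contra! h
    have h1 : a ≤ max (-(K 0)) 0 := min_le_left _ _
    rcases le_max_iff.1 h1 with h2 | h2 <;> linarith
  have hKn : a ≤ K (Fin.last n) := by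
    by_contra! h
    have h1 : a ≤ max (K (Fin.last n)) 0 := min_le_right _ _
    rcases le_max_iff.1 h1 with h2 | h2 <;> linarith
  have hgap : ∀ i : Fin n, K i.succ - K i.castSucc ≤ δ := fun i =>
    le_ciSup (f := fun i : Fin n => K i.succ - K i.castSucc) (Set.finite_range _).bddAbove i
  have hδ0 : 0 ≤ δ := Real.iSup_nonneg fun i => sub_nonneg.2 (hK (Fin.castSucc_lt_succ)).le
  set r := √δ + s with hr
  have hsδ : √δ ^ 2 = δ := Real.sq_sqrt hδ0
  have hsδ0 : 0 ≤ √δ := Real.sqrt_nonneg δ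
  have hr0 : 0 < r := by positivity
  have hcall : callFun μ a ≤ V * s ^ 2 := by
    rw [← hs2]
    refine (integral_max_sub_le (g := fun y => y) hp.le hpos (fun _ => rfl) hint).trans ?_
    gcongr
  have hput : callFun μ (-a) + -a ≤ V * s ^ 2 := by
    rw [← hs2, callFun_add_eq hμ hμ0]
    refine le_trans (le_of_eq ?_)
      ((integral_max_sub_le (g := fun y => -y) hp.le hpos (fun _ => abs_neg _) hint).trans
        (mul_le_mul_of_nonneg_right hV (by positivity)))
    refine integral_congr_ae (ae_of_all _ fun y => ?_)
    simp only
    congr 1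
    ring
  have hη : ∀ x, |callFun μ x - callFun ν x| ≤ δ + V * s ^ 2 :=
    abs_callFun_sub_le hμ hμ0 hν hν0 heq hδ0 hgap ((callFun_antitone hμ hKn).trans hcall)
      ((callFun_add_mono hμ (show K 0 ≤ -a by linarith)).trans hput)
  set ε := 2 * (1 + V) * r with hε
  have hε0 : 0 < ε := by positivity
  have hrsq : δ + s ^ 2 ≤ r ^ 2 := by
    rw [hr, add_sq, hsδ]
    nlinarith [mul_nonneg hsδ0 hs0.le]
  have hηε : 2 * (δ + V * s ^ 2) ≤ ε ^ 2 := by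
    have h1 : 2 * (δ + V * s ^ 2) ≤ 2 * (1 + V) * (δ + s ^ 2) := by
      nlinarith [mul_nonneg hV0 hδ0, sq_nonneg s]
    have h2 : 2 * (1 + V) ≤ (2 * (1 + V)) ^ 2 := by nlinarith
    calc 2 * (δ + V * s ^ 2) ≤ 2 * (1 + V) * (δ + s ^ 2) := h1
      _ ≤ (2 * (1 + V)) ^ 2 * r ^ 2 := by gcongr
      _ = ε ^ 2 := by rw [hε]; ring
  refine ⟨(levyDist_le hμ hν hη hε0 hηε).trans ?_, fun hcase => ?_⟩
  · rw [hε]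
    gcongr
    norm_num
  have har : a * r = a * √δ + a * s := by rw [hr]; ring
  -- In the main regime `δ`, `s ^ 2` and `r` are all at most `a * r`; otherwise `a * r ≥ 1` and a
  -- first-moment bound is enough.
  by_cases hgood : 1 ≤ a ∧ δ ≤ 1
  · obtain ⟨ha1, hδ1⟩ := hgood
    refine (wassersteinDist_le_of_cdf hμ hμ0 hν hν0 hpos.le hε0.le (cdf_le_cdf_add hμ hν hη hε0 hηε)
      (cdf_le_cdf_add hν hμ (fun x => by rw [abs_sub_comm]; exact hη x) hε0 hηε)).trans
      (ENNReal.ofReal_le_ofReal ?_)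
    -- The tails contribute at most `2 * δ + 6 * V * s ^ 2` and the bulk `2 * ε + 2 * a * ε`, in
    -- total `(10 + 14 * V) * (a * r)`.
    have h1 := (abs_le.1 (hη a)).1
    have h2 := (abs_le.1 (hη (-a))).1
    have hs1 : s ≤ 1 := Real.rpow_le_one_of_one_le_of_nonpos ha1 (by rw [hexp]; linarith)
    have hr_le : r ≤ a * r := le_mul_of_one_le_left hr0.le ha1
    have hδr : δ ≤ a * r := by
      have : δ ≤ √δ := by
        have := Real.sqrt_le_one.2 hδ1
        nlinarith
      linarith
    have hsr : s ^ 2 ≤ a * r := by nlinarith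
    have hVr : V * s ^ 2 ≤ V * (a * r) := mul_le_mul_of_nonneg_left hsr hV0
    have hεr : ε ≤ 2 * (1 + V) * (a * r) := by rw [hε]; gcongr
    have haε : a * ε = 2 * (1 + V) * (a * r) := by rw [hε]; ring
    have hVar : 0 ≤ V * (a * r) := by positivity
    have har0 : 0 ≤ a * r := by positivity
    linarith
  · refine (wassersteinDist_le_integral_abs hμ hν).trans (ENNReal.ofReal_le_ofReal ?_)
    have h1 : ∫ y, |y| ∂μ ≤ 1 + V := (integral_abs_le hp.le hint).trans (by linarith)
    -- One extreme strike is at distance exactly `a` from `0`; moving to it and back costs at most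
    -- `a`, by monotonicity of calls and puts.
    have h2 : callFun ν 0 ≤ a + callFun μ 0 := by
      have hmin : -(K 0) ≤ a ∨ K (Fin.last n) ≤ a := by
        have h0 : max (-(K 0)) 0 = -(K 0) := max_eq_left (by linarith)
        have hn : max (K (Fin.last n)) 0 = K (Fin.last n) := max_eq_left (by linarith)
        rw [ha, strikeBound, h0, hn]
        exact (min_choice _ _).imp Eq.ge Eq.ge
      rcases hmin with h | h
      · have h3 := callFun_antitone hν (show K 0 ≤ 0 by linarith)
        have h4 := callFun_add_mono hμ (show K 0 ≤ 0 by linarith)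
        simp only [heq] at h3 h4
        linarith
      · have h3 := callFun_add_mono hν (show 0 ≤ K (Fin.last n) by linarith)
        have h4 := callFun_antitone hμ (show 0 ≤ K (Fin.last n) by linarith)
        simp only [heq] at h3
        linarith
    have h3 := integral_abs_eq hμ hμ0
    rw [integral_abs_eq hν hν0]
    -- If `a ≥ 1` then `δ > 1`, so `r ≥ 1`. If `a < 1` then `p ≥ 3`, and `a * s = a ^ ((3 - p) / 2)
    -- ≥ 1`.
    have hkey : 1 ≤ a * r ∧ a ≤ a * r := by
      rcases le_or_gt 1 a with ha1 | ha1
      · have hδ1 : 1 ≤ √δ := Real.one_le_sqrt.2 (by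
          by_contra! h
          exact hgood ⟨ha1, h.le⟩)
        have : a ≤ a * r := le_mul_of_one_le_right hpos.le (by linarith)
        exact ⟨ha1.trans this, this⟩
      · have hp3 : 3 ≤ p := hcase.resolve_left (not_le.2 ha1)
        have has : 1 ≤ a * s := by
          have : a * s = a ^ (1 + (1 - p) / 2) := by
            rw [Real.rpow_add hpos, Real.rpow_one, hs, hexp]
          rw [this]
          exact Real.one_le_rpow_of_pos_of_le_one_of_nonpos hpos ha1.le (by linarith)
        have : 1 ≤ a * r := by
          rw [har]
          linarith [mul_nonneg hpos.le hsδ0]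
        exact ⟨this, ha1.le.trans this⟩
    have h4 : V * 1 ≤ V * (a * r) := mul_le_mul_of_nonneg_left hkey.1 hV0
    linarith [hkey.1, hkey.2]

lemma convexOn_abs_rpow {p : ℝ} (hp : 1 ≤ p) : ConvexOn ℝ Set.univ fun x : ℝ => |x| ^ p := by
  refine ⟨convex_univ, fun x _ y _ s t hs ht hst => ?_⟩
  have h1 : |s • x + t • y| ≤ s • |x| + t • |y| := by
    refine (abs_add_le _ _).trans_eq ?_
    simp [abs_mul, abs_of_nonneg hs, abs_of_nonneg ht]
  exact (Real.rpow_le_rpow (abs_nonneg _) h1 (by linarith)).trans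
    ((convexOn_rpow hp).2 (abs_nonneg x) (abs_nonneg y) hs ht hst)

end CallEmbedding

theorem mainTheorem9 (V : ℝ) :
    ∃ C : ℝ, 0 < C ∧
      ∀ p q : ℝ, p.HolderConjugate q →
      ∀ (m : ℕ) (μ : Fin (m + 1) → Measure ℝ), CallEmbedding.IsCenteredPeacock μ →
        Integrable (fun x : ℝ => |x| ^ p) (μ (Fin.last m)) →
        ∫ x, |x| ^ p ∂(μ (Fin.last m)) = V →
      ∀ (n : ℕ) (K : Fin (n + 1) → ℝ), StrictMono K → 0 < CallEmbedding.strikeBound K →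
      ∀ P : Measure (CallEmbedding.CanonicalSpace m),
        CallEmbedding.IsEmbedding K (CallEmbedding.callPrices μ K) P →
      ∀ i : Fin (m + 1),
        CallEmbedding.levyDist (μ i) (P.map (CallEmbedding.embeddedValue i)) ≤
          C * (√(CallEmbedding.mesh K) + CallEmbedding.strikeBound K ^ (-(p / (2 * q)))) ∧
        (1 ≤ CallEmbedding.strikeBound K ∨ 3 ≤ p →
          CallEmbedding.wassersteinDist (μ i) (P.map (CallEmbedding.embeddedValue i)) ≤
            ENNReal.ofReal (C * CallEmbedding.strikeBound K *
              (√(CallEmbedding.mesh K) +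
                CallEmbedding.strikeBound K ^ (-(p / (2 * q)))))) := by
  -- The sign of `V` is not yet known here; the maximum keeps the constant positive.
  refine ⟨20 * (1 + max V 0), by positivity, ?_⟩
  intro p q hpq m μ hμ hint hV n K hK hpos P hP i
  have hV0 : 0 ≤ V := hV ▸ integral_nonneg fun x => by positivity
  rw [max_eq_left hV0]
  have := hP.isStoppingLaw.isProbabilityMeasure
  have := hμ.isProbabilityMeasure i
  have hmeas := CallEmbedding.measurable_embeddedValue (m := m) i
  have := Measure.isProbabilityMeasure_map (μ := P) hmeas.aemeasurable
  obtain ⟨hB, hB0⟩ := hP.isStoppingLaw.integrable_and_integral_embeddedValue i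
  -- Convexity of `|x| ^ p` transfers the moment bound from the last marginal to the `i`-th.
  obtain ⟨hpi, hpV⟩ := hμ.convex_order i (Fin.last m) (Fin.le_last i) _
    (CallEmbedding.convexOn_abs_rpow hpq.lt.le) hint
  refine CallEmbedding.levyDist_wassersteinDist_le (hμ.integrable_id i) (hμ.mean_zero i)
    ((integrable_map_measure (by fun_prop) hmeas.aemeasurable).2 hB) ?_ hpq hpi
    (hpV.trans_eq hV) hK hpos fun j => ?_
  · rw [integral_map hmeas.aemeasurable (by fun_prop)]
    exact hB0
  · rw [CallEmbedding.callFun, integral_map hmeas.aemeasurable (by fun_prop)]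
    exact hP.price_eq i j
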